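/- Let $f_0,f_1\in\mathbb C[x_0,\dots,x_5]$ be homogeneous cubics such that $X=\{f_0=f_1=0\}\subset\mathbb P^5$ is a smooth complete intersection. Let $S=\mathbb C[p_0,p_1,x_0,\dots,x_5]$, bigraded by a toric degree ($\deg p_a=-3$, $\deg x_i=1$) and an even $R$-charge ($p_a$ has charge $2$, $x_i$ has charge $0$), let $W=p_0f_0+p_1f_1$ and $S'=S/(W)$. Write $(n)$ and $\{m\}$ for the shifts of the toric grading and of the $R$-grading. Let $\mathrm{DGr}S(W)$ be the category of matrix factorizations $P_1\overset{u_1}{\underset{u_0}{\rightleftarrows}}P_0$, $u_0u_1=u_1u_0=W$, with $P_0,P_1$ bigraded free $S$-modules of finite rank, $u_1$ of bidegree $0$, and $u_0$ of toric degree $0$ and $R$-degree $2$; morphisms are taken up to homotopy, and the shift is $P[1]=(P_0\rightleftarrows P_1\{2\})$, so that $[2]=\{2\}$. Let $T_\Sigma\subset\mathrm{DGr}S(W)$ be the triangulated subcategory generated by the matrix factorizations $P$ for which $\operatorname{coker}u_1$ is a $k$-th syzygy module (for some $k\ge 0$, in a resolution by graded free $S'$-modules of finite rank) of a finitely generated bigraded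 $S'$-module annihilated by a power of the ideal $(p_0,p_1)$. The category of D-branes in the hybrid phase is the Verdier quotient $\mathrm{DGr}S(W)/T_\Sigma$. Let $\mathsf w$ be the matrix factorization associated with the module $S/(x_0,\dots,x_5)$, that is, the Koszul matrix factorization of $W=\sum_{i=0}^5x_ig_i$ with $g_i=\tfrac13\,\partial W/\partial x_i$: its underlying module is the exterior algebra over $S$ on generators $e_0,\dots,e_5$, with even part $P_0$ and odd part $P_1$, its $k$-th exterior power is a direct sum of copies of $S(-k)\{2\lfloor k/2\rfloor\}$, and its differential is contraction with $(x_0,\dots,x_5)$ plus left exterior multiplication by $\sum_ig_ie_i$. For $(\xi_0,\xi_1)\in\mathbb C^2\setminus\{(0,0)\}$ and $n\in\mathbb Z$ put $$\mathscr P_{[\xi_0,\xi_1]}(n)=\operatorname{Cone}\Bigl(\mathsf w(n+3)[-2]\xrightarrow{\ \xi_0p_1-\xi_1p_0\ }\mathsf w(n)\Bigr).$$ Theorem. For all $(\xi_0,\xi_1)\in\mathbb C^2\setminus\{(0,0)\}$ and all $n\in\mathbb Z$ there is an isomorphism $$\mathscr P_{[\xi_0,\xi_1]}(n+3)\;\cong\;\mathscr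 P_{[\xi_0,\xi_1]}(n)[2]$$ in the category of D-branes $\mathrm{DGr}S(W)/T_\Sigma$. -/

import Mathlib

open CategoryTheory

noncomputable section

namespace HybridPhase

/-- The homogeneous coordinate ring `S = ℂ[p₀, p₁, x₀, …, x₅]`. -/
abbrev S : Type := MvPolynomial (Fin 2 ⊕ Fin 6) ℂ

/-- The coordinate `p_a`. -/
def p (a : Fin 2) : S := MvPolynomial.X (Sum.inl a)

/-- The coordinate `x_i`. -/
def x (i : Fin 6) : S := MvPolynomial.X (Sum.inr i)

/-- The bigrading of `S`. The first component is the toric degree, the second one is *half* of the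
`R`-charge (which takes values in `2ℤ`): `p_a` has toric degree `-3` and `R`-charge `2`, and `x_i`
has toric degree `1` and `R`-charge `0`. -/
def wt : Fin 2 ⊕ Fin 6 → ℤ × ℤ := Sum.elim (fun _ => (-3, 1)) (fun _ => (1, 0))

/-- `s ∈ S` is bihomogeneous of bidegree `d`. -/
abbrev Homog (s : S) (d : ℤ × ℤ) : Prop := MvPolynomial.IsWeightedHomogeneous wt s d

/-- A bigraded free `S`-module of finite rank `⨁ i, S(a_i){2 r_i}` is encoded by a finite index type
`ι` and the function `deg : ι → ℤ × ℤ`, `deg i = (a_i, r_i)`. Here `S(a){2r}` is `S` with its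
part of bidegree `(k, l)` equal to the part of bidegree `(k + a, l + r)` of `S`.
`IsGr deg deg' d A` says that the matrix `A`, seen as an `S`-linear map
`⨁ j, S(a_j){2 r_j} → ⨁ i, S(a'_i){2 r'_i}`, is homogeneous of bidegree `d`. -/
def IsGr {ι ι' : Type} (deg : ι → ℤ × ℤ) (deg' : ι' → ℤ × ℤ) (d : ℤ × ℤ) (A : Matrix ι' ι S) :
    Prop :=
  ∀ i j, Homog (A i j) (deg' i - deg j + d)

namespace IsGr

variable {ι ι' κ κ' : Type} {deg : ι → ℤ × ℤ} {deg' : ι' → ℤ × ℤ} {d : ℤ × ℤ}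

theorem congr {deg₁ : ι → ℤ × ℤ} {deg₁' : ι' → ℤ × ℤ} {d₁ : ℤ × ℤ} {A : Matrix ι' ι S}
    (hA : IsGr deg deg' d A)
    (h : ∀ i j, deg' i - deg j + d = deg₁' i - deg₁ j + d₁) : IsGr deg₁ deg₁' d₁ A :=
  fun i j => h i j ▸ hA i j

theorem zero : IsGr deg deg' d 0 :=
  fun _ _ => MvPolynomial.isWeightedHomogeneous_zero ℂ wt _

theorem neg {A : Matrix ι' ι S} (hA : IsGr deg deg' d A) : IsGr deg deg' d (-A) := fun i j =>
  (MvPolynomial.weightedHomogeneousSubmodule ℂ wt _).neg_mem (hA i j)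

theorem smul_one [DecidableEq ι] {deg₁ : ι → ℤ × ℤ} {s : S} {e : ℤ × ℤ} (hs : Homog s e)
    (h : ∀ i, e = deg₁ i - deg i + d) : IsGr deg deg₁ d (s • (1 : Matrix ι ι S)) := by
  intro i j
  by_cases hij : i = j
  · subst hij
    simpa [← h i] using hs
  · simpa [Matrix.one_apply_ne hij] using MvPolynomial.isWeightedHomogeneous_zero ℂ wt _

theorem one [DecidableEq ι] : IsGr deg deg 0 (1 : Matrix ι ι S) := by
  simpa using smul_one (deg := deg) (deg₁ := deg) (d := 0)
    (MvPolynomial.isWeightedHomogeneous_one ℂ wt) (by simp)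

theorem mul [Fintype ι'] {deg'' : κ → ℤ × ℤ} {e : ℤ × ℤ} {B : Matrix κ ι' S} {A : Matrix ι' ι S}
    (hB : IsGr deg' deg'' e B) (hA : IsGr deg deg' d A) : IsGr deg deg'' (d + e) (B * A) := by
  intro i j
  rw [Matrix.mul_apply]
  refine MvPolynomial.IsWeightedHomogeneous.sum _ _ _ fun k _ => ?_
  have := (hB i k).mul (hA k j)
  convert this using 1
  abel

theorem fromBlocks {degk : κ → ℤ × ℤ} {degk' : κ' → ℤ × ℤ} {A : Matrix ι' ι S}
    {B : Matrix ι' κ S} {C : Matrix κ' ι S} {D : Matrix κ' κ S} (hA : IsGr deg deg' d A)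
    (hB : IsGr degk deg' d B) (hC : IsGr deg degk' d C) (hD : IsGr degk degk' d D) :
    IsGr (Sum.elim deg degk) (Sum.elim deg' degk') d (Matrix.fromBlocks A B C D) := by
  rintro (i | i) (j | j)
  · exact hA i j
  · exact hB i j
  · exact hC i j
  · exact hD i j

end IsGr

/-- A graded matrix factorization of `W`: graded free modules `P₀` and `P₁` of finite rank
(given by `ι₀`, `deg₀` and `ι₁`, `deg₁`), with maps `u₁ : P₁ → P₀` of degree `0` and
`u₀ : P₀ → P₁` of `R`-degree `2` and toric degree `0`, such that `u₀ u₁ = u₁ u₀ = W`. -/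
structure MF (W : S) where
  ι₀ : Type
  ι₁ : Type
  [fintype₀ : Fintype ι₀]
  [fintype₁ : Fintype ι₁]
  [decEq₀ : DecidableEq ι₀]
  [decEq₁ : DecidableEq ι₁]
  deg₀ : ι₀ → ℤ × ℤ
  deg₁ : ι₁ → ℤ × ℤ
  u₁ : Matrix ι₀ ι₁ S
  u₀ : Matrix ι₁ ι₀ S
  gr₁ : IsGr deg₁ deg₀ 0 u₁
  gr₀ : IsGr deg₀ deg₁ (0, 1) u₀
  fact₀ : u₁ * u₀ = W • (1 : Matrix ι₀ ι₀ S)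
  fact₁ : u₀ * u₁ = W • (1 : Matrix ι₁ ι₁ S)

attribute [instance] MF.fintype₀ MF.fintype₁ MF.decEq₀ MF.decEq₁

namespace MF

variable {W : S}

/-- A (strict) morphism of matrix factorizations. -/
@[ext]
structure Hom (P Q : MF W) where
  f₀ : Matrix Q.ι₀ P.ι₀ S
  f₁ : Matrix Q.ι₁ P.ι₁ S
  gr₀ : IsGr P.deg₀ Q.deg₀ 0 f₀
  gr₁ : IsGr P.deg₁ Q.deg₁ 0 f₁
  comm₁ : f₀ * P.u₁ = Q.u₁ * f₁
  comm₀ : f₁ * P.u₀ = Q.u₀ * f₀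

/-- The category of graded matrix factorizations of `W` and strict morphisms. -/
instance : Category (MF W) where
  Hom := Hom
  id P := ⟨1, 1, IsGr.one, IsGr.one, by simp, by simp⟩
  comp f g :=
    ⟨g.f₀ * f.f₀, g.f₁ * f.f₁, by simpa using g.gr₀.mul f.gr₀, by simpa using g.gr₁.mul f.gr₁,
      by rw [Matrix.mul_assoc, f.comm₁, ← Matrix.mul_assoc, g.comm₁, Matrix.mul_assoc],
      by rw [Matrix.mul_assoc, f.comm₀, ← Matrix.mul_assoc, g.comm₀, Matrix.mul_assoc]⟩
  id_comp f := Hom.ext (Matrix.mul_one _) (Matrix.mul_one _)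
  comp_id f := Hom.ext (Matrix.one_mul _) (Matrix.one_mul _)
  assoc f g h := Hom.ext (Matrix.mul_assoc _ _ _).symm (Matrix.mul_assoc _ _ _).symm

/-- Two morphisms `f, g : P → Q` are homotopic: there are `h₀ : P₀ → Q₁` and `h₁ : P₁ → Q₀{-2}` of
degree `0` with `f₀ - g₀ = u₁ h₀ + h₁ u₀` and `f₁ - g₁ = u₀ h₁ + h₀ u₁`. -/
def homotopic (W : S) : HomRel (MF W) := fun P Q (f g : Hom P Q) =>
  ∃ (h₀ : Matrix Q.ι₁ P.ι₀ S) (h₁ : Matrix Q.ι₀ P.ι₁ S),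
    IsGr P.deg₀ Q.deg₁ 0 h₀ ∧ IsGr P.deg₁ Q.deg₀ (0, -1) h₁ ∧
    f.f₀ - g.f₀ = Q.u₁ * h₀ + h₁ * P.u₀ ∧
    f.f₁ - g.f₁ = Q.u₀ * h₁ + h₀ * P.u₁

/-- The twist `P(n)` by the toric grading. -/
@[simps]
def twist (P : MF W) (n : ℤ) : MF W where
  ι₀ := P.ι₀
  ι₁ := P.ι₁
  deg₀ i := P.deg₀ i + (n, 0)
  deg₁ i := P.deg₁ i + (n, 0)
  u₁ := P.u₁
  u₀ := P.u₀
  gr₁ := P.gr₁.congr fun i j => by abel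
  gr₀ := P.gr₀.congr fun i j => by abel
  fact₀ := P.fact₀
  fact₁ := P.fact₁

/-- The shift functor on objects: `P[1]` is `P₀ ⇄ P₁{2}`. -/
@[simps]
def shift (P : MF W) : MF W where
  ι₀ := P.ι₁
  ι₁ := P.ι₀
  deg₀ i := P.deg₁ i + (0, 1)
  deg₁ := P.deg₀
  u₁ := P.u₀
  u₀ := P.u₁
  gr₁ := P.gr₀.congr fun i j => by abel
  gr₀ := P.gr₁.congr fun i j => by abel
  fact₀ := P.fact₁
  fact₁ := P.fact₀

/-- The inverse shift on objects: `P[-1]` is `P₀{-2} ⇄ P₁`. -/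
@[simps]
def unshift (P : MF W) : MF W where
  ι₀ := P.ι₁
  ι₁ := P.ι₀
  deg₀ := P.deg₁
  deg₁ i := P.deg₀ i - (0, 1)
  u₁ := P.u₀
  u₀ := P.u₁
  gr₁ := P.gr₀.congr fun i j => by abel
  gr₀ := P.gr₁.congr fun i j => by abel
  fact₀ := P.fact₁
  fact₁ := P.fact₀

/-- The mapping cone of `f : P → Q`, namely `Q₁ ⊕ P₀ ⇄ Q₀ ⊕ P₁{2}`. -/
def cone {P Q : MF W} (f : P ⟶ Q) : MF W where
  ι₀ := Q.ι₀ ⊕ P.ι₁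
  ι₁ := Q.ι₁ ⊕ P.ι₀
  deg₀ := Sum.elim Q.deg₀ fun i => P.deg₁ i + (0, 1)
  deg₁ := Sum.elim Q.deg₁ P.deg₀
  u₁ := Matrix.fromBlocks Q.u₁ (Hom.f₀ f) 0 (-P.u₀)
  u₀ := Matrix.fromBlocks Q.u₀ (Hom.f₁ f) 0 (-P.u₁)
  gr₁ := .fromBlocks Q.gr₁ (Hom.gr₀ f) .zero (P.gr₀.neg.congr fun i j => by abel)
  gr₀ := .fromBlocks Q.gr₀ ((Hom.gr₁ f).congr fun i j => by abel) .zero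
    (P.gr₁.neg.congr fun i j => by abel)
  fact₀ := by
    rw [Matrix.fromBlocks_multiply, ← Matrix.fromBlocks_one, Matrix.fromBlocks_smul, Q.fact₀]
    simp [P.fact₁, ← Hom.comm₁ f]
  fact₁ := by
    rw [Matrix.fromBlocks_multiply, ← Matrix.fromBlocks_one, Matrix.fromBlocks_smul, Q.fact₁]
    simp [P.fact₀, ← Hom.comm₀ f]

/-- Multiplication by a bihomogeneous `s ∈ S` of toric degree `n - m` and `R`-charge `2`, as a
morphism `P(m)[-2] → P(n)`. -/
def mulHom (P : MF W) (s : S) (m n : ℤ) (hs : Homog s (n - m, 1)) :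
    (P.twist m).unshift.unshift ⟶ P.twist n :=
  Hom.mk (P := (P.twist m).unshift.unshift) (Q := P.twist n)
    (s • (1 : Matrix P.ι₀ P.ι₀ S)) (s • (1 : Matrix P.ι₁ P.ι₁ S))
    (.smul_one (deg := fun i => P.deg₀ i + (m, 0) - (0, 1)) (deg₁ := fun i => P.deg₀ i + (n, 0))
      hs fun i => by ext <;> simp)
    (.smul_one (deg := fun i => P.deg₁ i + (m, 0) - (0, 1)) (deg₁ := fun i => P.deg₁ i + (n, 0))
      hs fun i => by ext <;> simp)
    (show (s • (1 : Matrix P.ι₀ P.ι₀ S)) * P.u₁ = P.u₁ * (s • (1 : Matrix P.ι₁ P.ι₁ S)) by simp)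
    (show (s • (1 : Matrix P.ι₁ P.ι₁ S)) * P.u₀ = P.u₀ * (s • (1 : Matrix P.ι₀ P.ι₀ S)) by simp)

/-! ### Koszul matrix factorizations -/

/-- The matrix factorization `0 ⇄ S` of the zero potential. -/
def unit : MF 0 where
  ι₀ := Unit
  ι₁ := Empty
  deg₀ _ := 0
  deg₁ _ := 0
  u₁ := 0
  u₀ := 0
  gr₁ := .zero
  gr₀ := .zero
  fact₀ := by simp
  fact₁ := by simp

/-- The tensor product of `P` with the rank one matrix factorization of `a * b` given by `a` and
`b`. If `D` is the differential of `P`, this is `P ⊕ e ∧ P` with `e` an odd generator and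
differential `q ↦ D q + b e ∧ q`, `e ∧ q ↦ a q - e ∧ D q`. -/
def koszulStep (P : MF W) (a b : S) (d : ℤ × ℤ) (ha : Homog a d) (hb : Homog b ((0, 1) - d)) :
    MF (a * b + W) where
  ι₀ := P.ι₀ ⊕ P.ι₁
  ι₁ := P.ι₁ ⊕ P.ι₀
  deg₀ := Sum.elim P.deg₀ fun i => P.deg₁ i + ((0, 1) - d)
  deg₁ := Sum.elim P.deg₁ fun i => P.deg₀ i - d
  u₁ := Matrix.fromBlocks P.u₁ (a • 1) (b • 1) (-P.u₀)
  u₀ := Matrix.fromBlocks P.u₀ (a • 1) (b • 1) (-P.u₁)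
  gr₁ := .fromBlocks P.gr₁ (.smul_one ha fun i => by abel) (.smul_one hb fun i => by abel)
    (P.gr₀.neg.congr fun i j => by abel)
  gr₀ := .fromBlocks P.gr₀ (.smul_one ha fun i => by abel) (.smul_one hb fun i => by abel)
    (P.gr₁.neg.congr fun i j => by abel)
  fact₀ := by
    rw [Matrix.fromBlocks_multiply, ← Matrix.fromBlocks_one, Matrix.fromBlocks_smul]
    simp [P.fact₀, P.fact₁, smul_smul, add_smul, add_comm, mul_comm]
  fact₁ := by
    rw [Matrix.fromBlocks_multiply, ← Matrix.fromBlocks_one, Matrix.fromBlocks_smul]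
    simp [P.fact₀, P.fact₁, smul_smul, add_smul, add_comm, mul_comm]

/-- The Koszul matrix factorization of `∑ i, a i * b i`, the tensor product of the rank one
factorizations `(a i, b i)`, `i` running through a list. Its underlying module is the exterior
algebra on generators `e i`, and its differential is contraction with `a` plus exterior
multiplication with `∑ i, b i • e i`. -/
def koszul {κ : Type} (a b : κ → S) (d : κ → ℤ × ℤ) (ha : ∀ i, Homog (a i) (d i))
    (hb : ∀ i, Homog (b i) ((0, 1) - d i)) :
    (l : List κ) → MF (l.map fun i => a i * b i).sum
  | [] => unit
  | i :: l => koszulStep (koszul a b d ha hb l) (a i) (b i) (d i) (ha i) (hb i)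

/-- Rewriting the potential along an equality. -/
@[simps]
def ofEq {W' : S} (h : W = W') (P : MF W) : MF W' where
  ι₀ := P.ι₀
  ι₁ := P.ι₁
  deg₀ := P.deg₀
  deg₁ := P.deg₁
  u₁ := P.u₁
  u₀ := P.u₀
  gr₁ := P.gr₁
  gr₀ := P.gr₀
  fact₀ := h ▸ P.fact₀
  fact₁ := h ▸ P.fact₁

end MF

/-- The category `DGrS(W)`: matrix factorizations of `W`, with morphisms up to homotopy. -/
abbrev DGr (W : S) : Type 1 := CategoryTheory.Quotient (MF.homotopic W)

/-- The object of `DGrS(W)` given by a matrix factorization. -/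
abbrev DGr.of {W : S} (P : MF W) : DGr W := (CategoryTheory.Quotient.functor (MF.homotopic W)).obj P

/-! ### The subcategory of objects supported on the Cox ideal, and the quotient

Finitely generated bigraded modules over the Noetherian ring `S' = S / (W)` are exactly the
cokernels over `S'` of homogeneous matrices between graded free modules of finite rank. -/

/-- The linear map between free modules over `S' = S / (W)` defined by the matrix `A`. -/
def redMap (W : S) {ι ι' : Type} [Fintype ι] (A : Matrix ι' ι S) :
    (ι → S ⧸ Ideal.span {W}) →ₗ[S ⧸ Ideal.span {W}] (ι' → S ⧸ Ideal.span {W}) :=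
  (A.map (Ideal.Quotient.mk (Ideal.span {W}))).mulVecLin

/-- `IsHigherSyzygy W degG₁ degG₀ u degF₁ degF₀ A`, for `u : G₁ → G₀` and `A : F₁ → F₀`: over `S' = S / (W)`, the graded module
`coker u` is a `k`-th syzygy module of the graded module `coker A` for some `k ≥ 0`. In other
words, there is an exact sequence of graded `S'`-modules
`F_{k+1} → F_k → ⋯ → F_1 → F_0 → coker A → 0` in which all the `F_i` are graded free of finite rank,
the map `F_{k+1} → F_k` is `u`, and the map `F_1 → F_0` is `A` (so `u = A` if `k = 0`). -/
inductive IsHigherSyzygy (W : S) {κ₁ κ₀ : Type} (degG₁ : κ₁ → ℤ × ℤ) (degG₀ : κ₀ → ℤ × ℤ)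
    (u : Matrix κ₀ κ₁ S) :
    {ι₁ ι₀ : Type} → (ι₁ → ℤ × ℤ) → (ι₀ → ℤ × ℤ) → Matrix ι₀ ι₁ S → Prop
  | refl : IsHigherSyzygy W degG₁ degG₀ u degG₁ degG₀ u
  | step {ι₂ ι₁ ι₀ : Type} [Fintype ι₂] [Fintype ι₁] [Fintype ι₀]
      (degF₂ : ι₂ → ℤ × ℤ) (degF₁ : ι₁ → ℤ × ℤ) (degF₀ : ι₀ → ℤ × ℤ)
      (B : Matrix ι₁ ι₂ S) (A : Matrix ι₀ ι₁ S)
      (hB : IsHigherSyzygy W degG₁ degG₀ u degF₂ degF₁ B)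
      (hA : IsGr degF₁ degF₀ 0 A)
      (exact : Function.Exact (redMap W B) (redMap W A)) :
      IsHigherSyzygy W degG₁ degG₀ u degF₁ degF₀ A

/-- The Cox ideal `(p₀, p₁)` of the hybrid phase. -/
def coxIdeal : Ideal S := Ideal.span {p 0, p 1}

/-- The `S'`-module `coker A` is annihilated by a power of the Cox ideal. -/
def KilledByCoxPower (W : S) {ι₁ ι₀ : Type} [Fintype ι₁] (A : Matrix ι₀ ι₁ S) : Prop :=
  ∃ N : ℕ, ∀ s ∈ coxIdeal ^ N, ∀ v : ι₀ → S ⧸ Ideal.span {W},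
    Ideal.Quotient.mk (Ideal.span {W}) s • v ∈ LinearMap.range (redMap W A)

/-- The objects of the triangulated subcategory `T_Σ` of `DGrS(W)` generated by the matrix
factorizations that correspond to the finitely generated graded `S / (W)`-modules annihilated by a
power of the Cox ideal. A matrix factorization `P` corresponds to a module `M`, up to a homological
shift, when a graded free `S / (W)`-resolution of `M` has `P` as its 2-periodic tail, that
is, when `coker u₁` is a higher syzygy module of `M`. -/
inductive InT {W : S} : MF W → Prop
  | ofModule (P : MF W) {ι₁ ι₀ : Type} [Fintype ι₁] [Fintype ι₀]
      (degF₁ : ι₁ → ℤ × ℤ) (degF₀ : ι₀ → ℤ × ℤ) (A : Matrix ι₀ ι₁ S)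
      (hA : IsGr degF₁ degF₀ 0 A) (hkill : KilledByCoxPower W A)
      (syz : IsHigherSyzygy W P.deg₁ P.deg₀ P.u₁ degF₁ degF₀ A) : InT P
  | shift (P : MF W) (hP : InT P) : InT P.shift
  | unshift (P : MF W) (hP : InT P) : InT P.unshift
  | cone {P Q : MF W} (f : P ⟶ Q) (hP : InT P) (hQ : InT Q) : InT (MF.cone f)
  | iso {P Q : MF W} (e : DGr.of P ≅ DGr.of Q) (hP : InT P) : InT Q

/-- The morphisms of `DGrS(W)` whose cone lies in `T_Σ`. -/
def coneInT (W : S) : MorphismProperty (DGr W) := fun X Y f =>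
  ∃ φ : X.as ⟶ Y.as, (CategoryTheory.Quotient.functor (MF.homotopic W)).map φ = f ∧
    InT (MF.cone φ)

/-- The category of D-branes in the hybrid phase: the Verdier quotient `DGrS(W) / T_Σ`, i.e. the
localization of `DGrS(W)` at the morphisms whose cone lies in `T_Σ`. -/
abbrev DBrane (W : S) : Type 1 := (coneInT W).Localization

/-- The D-brane given by a matrix factorization. -/
def brane {W : S} (P : MF W) : DBrane W := (coneInT W).Q.obj (DGr.of P)

/-! ### The bicubic model -/

/-- `f_a(x)` as an element of `S`. -/
def inS (f : MvPolynomial (Fin 6) ℂ) : S := MvPolynomial.rename Sum.inr f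

/-- The superpotential `W = p₀ f₀(x) + p₁ f₁(x)`. -/
def superpotential (f : Fin 2 → MvPolynomial (Fin 6) ℂ) : S :=
  ∑ a, p a * inS (f a)

/-- `X = {f₀ = f₁ = 0} ⊆ ℙ⁵` is a smooth complete intersection (Jacobian criterion). -/
def IsSmoothCI (f : Fin 2 → MvPolynomial (Fin 6) ℂ) : Prop :=
  ∀ v : Fin 6 → ℂ, v ≠ 0 → (∀ a, MvPolynomial.eval v (f a) = 0) →
    LinearIndependent ℂ fun a : Fin 2 => fun i : Fin 6 =>
      MvPolynomial.eval v (MvPolynomial.pderiv i (f a))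

/-- `g_i = (1/3) ∂W/∂x_i`, so that `W = ∑ i, x_i g_i` by Euler's identity. -/
def gCoeff (f : Fin 2 → MvPolynomial (Fin 6) ℂ) (i : Fin 6) : S :=
  ∑ a, p a * inS (MvPolynomial.C (3⁻¹ : ℂ) * MvPolynomial.pderiv i (f a))

theorem homog_x (i : Fin 6) : Homog (x i) (1, 0) :=
  MvPolynomial.isWeightedHomogeneous_X ℂ wt (Sum.inr i)

theorem homog_p (a : Fin 2) : Homog (p a) (-3, 1) :=
  MvPolynomial.isWeightedHomogeneous_X ℂ wt (Sum.inl a)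

theorem homog_inS {f : MvPolynomial (Fin 6) ℂ} {n : ℕ} (hf : f.IsHomogeneous n) :
    Homog (inS f) ((n : ℤ), 0) := by
  rw [inS, f.as_sum, map_sum]
  refine MvPolynomial.IsWeightedHomogeneous.sum _ _ _ fun m hm => ?_
  rw [MvPolynomial.rename_monomial]
  refine MvPolynomial.isWeightedHomogeneous_monomial _ _ _ ?_
  have h : m.degree = n := by
    rw [Finsupp.degree_eq_weight_one]
    exact hf (MvPolynomial.mem_support_iff.mp hm)
  rw [Finsupp.weight_apply, Finsupp.sum_mapDomain_index (by simp) (by simp [add_smul]), ← h,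
    Finsupp.degree_eq_sum]
  rw [Finsupp.sum_fintype _ _ (by simp)]
  ext <;> simp [wt, Prod.fst_sum, Prod.snd_sum]

theorem homog_gCoeff {f : Fin 2 → MvPolynomial (Fin 6) ℂ} (hf : ∀ a, (f a).IsHomogeneous 3)
    (i : Fin 6) : Homog (gCoeff f i) ((0, 1) - (1, 0)) := by
  refine MvPolynomial.IsWeightedHomogeneous.sum _ _ _ fun a _ => ?_
  have h := ((MvPolynomial.isHomogeneous_C (Fin 6) (3⁻¹ : ℂ)).mul ((hf a).pderiv (i := i)))
  exact (homog_p a).mul (homog_inS h)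

theorem sum_x_mul_gCoeff {f : Fin 2 → MvPolynomial (Fin 6) ℂ} (hf : ∀ a, (f a).IsHomogeneous 3) :
    ((List.finRange 6).map fun i => x i * gCoeff f i).sum = superpotential f := by
  have key : ∀ a, ∑ i, x i * inS (MvPolynomial.C (3⁻¹ : ℂ) * MvPolynomial.pderiv i (f a)) =
      inS (f a) := by
    intro a
    have h : ∑ i, MvPolynomial.X i * (MvPolynomial.C (3⁻¹ : ℂ) * MvPolynomial.pderiv i (f a)) =
        f a := by
      simp_rw [mul_left_comm (MvPolynomial.X _), ← Finset.mul_sum, (hf a).sum_X_mul_pderiv, nsmul_eq_mul,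
        ← mul_assoc]
      rw [← map_natCast (MvPolynomial.C (σ := Fin 6) (R := ℂ)) 3, ← map_mul]
      norm_num
    conv_rhs => rw [← h]
    simp [inS, x]
  rw [← List.ofFn_eq_map, List.sum_ofFn]
  simp only [gCoeff, Finset.mul_sum, superpotential]
  rw [Finset.sum_comm]
  refine Finset.sum_congr rfl fun a _ => ?_
  simp_rw [mul_left_comm _ (p a), ← Finset.mul_sum, key]

theorem homog_linear (ξ : Fin 2 → ℂ) (n : ℤ) :
    Homog (MvPolynomial.C (ξ 0) * p 1 - MvPolynomial.C (ξ 1) * p 0) (n - (n + 3), 1) := by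
  have h : ∀ (c : ℂ) (a : Fin 2), Homog (MvPolynomial.C c * p a) (n - (n + 3), 1) := fun c a => by
    have := (MvPolynomial.isWeightedHomogeneous_C wt c).mul (homog_p a)
    convert this using 1
    ext <;> simp
  exact (MvPolynomial.weightedHomogeneousSubmodule ℂ wt _).sub_mem (h _ _) (h _ _)

/-- The matrix factorization `w` associated with the module `S / (x₀, …, x₅)`: the Koszul matrix
factorization of `W = ∑ i, x_i g_i`. Its even and odd parts are the even and odd exterior powers,
where the summand `Λᵏ` is a sum of copies of `S(-k){2 ⌊k/2⌋}`. -/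
def wMF (f : Fin 2 → MvPolynomial (Fin 6) ℂ) (hf : ∀ a, (f a).IsHomogeneous 3) :
    MF (superpotential f) :=
  MF.ofEq (sum_x_mul_gCoeff hf)
    (MF.koszul x (gCoeff f) (fun _ => (1, 0)) homog_x (homog_gCoeff hf) (List.finRange 6))

/-- The 0-brane `P_ξ(n) = Cone (w(n+3)[-2] → w(n))`, the map being multiplication by
`ξ₀ p₁ - ξ₁ p₀`. -/
def zeroBrane (f : Fin 2 → MvPolynomial (Fin 6) ℂ)
    (hf : ∀ a, (f a).IsHomogeneous 3) (ξ : Fin 2 → ℂ) (n : ℤ) : MF (superpotential f) :=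
  MF.cone ((wMF f hf).mulHom (MvPolynomial.C (ξ 0) * p 1 - MvPolynomial.C (ξ 1) * p 0)
    (n + 3) n (homog_linear ξ n))

end HybridPhase

end

open CategoryTheory

noncomputable section

/-! Choose `η` with `ξ₀η₁ - ξ₁η₀ = 1`. Multiplication by `η₀p₁ - η₁p₀` is a morphism from the brane
twisted by `n + 3` to the double shift of the brane twisted by `n`. It becomes invertible in the
quotient as soon as its cone lies in `T_Σ`. Up to grading, this cone is the Koszul factorization on
the sequence `x₀, …, x₅, ξ₀p₁ - ξ₁p₀, η₀p₁ - η₁p₀`, whose exterior multiplication part is `(g₀, …,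
g₅, 0, 0)`. The two linear forms span the same space as `p₀, p₁`, so the sequence is regular and the
associated module is killed by the Cox ideal.

The main work is to show that such a factorization is the periodic tail of a resolution over `S' =
S/(W)`. The Koszul complex resolves `S/I` over `S`, and exterior multiplication is a null homotopy
of `W` on it. The classical construction then gives an `S'`-resolution whose term in degree `n` is
the sum of the exterior powers of level at most `n` and of the parity of `n`, with differential
contraction plus exterior multiplication. Once `n` exceeds the top exterior power, nothing is
truncated and the factorization itself appears.

`LevelSplit.exists_lift` is the exactness argument, `KoszulResolution.step` adjoins a regular
element, and `KoszulResolution.inT` assembles the resolution. Regularity is checked by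
`mem_of_mul_mem`, using retractions of `S`. Smoothness serves only to give `W ≠ 0`. -/

namespace HybridPhase

/-! ### Levelled matrices and lifting modulo W -/

section KoszulResolution

variable {R : Type} [CommRing R] {ι κ : Type}

/-- A decomposition of a matrix between levelled index types into a part `d` that lowers the level
by one and a part `h` that raises it by one. -/
structure LevelSplit (ℓ : ι → ℕ) (ℓ' : κ → ℕ) (u : Matrix ι κ R) where
  d : Matrix ι κ R
  h : Matrix ι κ R
  eq_add : u = d + h
  lvl_d : ∀ i k, d i k ≠ 0 → ℓ' k = ℓ i + 1
  lvl_h : ∀ i k, h i k ≠ 0 → ℓ i = ℓ' k + 1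

namespace LevelSplit

variable {ℓ : ι → ℕ} {ℓ' : κ → ℕ} {u : Matrix ι κ R} {u' : Matrix κ ι R}

theorem apply_eq_zero (s : LevelSplit ℓ ℓ' u) {i : ι} {k : κ} (h₁ : ℓ' k ≠ ℓ i + 1)
    (h₂ : ℓ i ≠ ℓ' k + 1) : u i k = 0 := by
  rw [s.eq_add, Matrix.add_apply, not_imp_comm.1 (s.lvl_d i k) h₁,
    not_imp_comm.1 (s.lvl_h i k) h₂, add_zero]

theorem d_mulVec_eq_zero [Fintype κ] (s : LevelSplit ℓ ℓ' u) {v : κ → R} {i : ι}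
    (hv : ∀ k, ℓ' k = ℓ i + 1 → v k = 0) : (s.d.mulVec v) i = 0 :=
  Finset.sum_eq_zero fun k _ => by
    change s.d i k * v k = 0
    by_cases hk : ℓ' k = ℓ i + 1
    · rw [hv k hk, mul_zero]
    · rw [not_imp_comm.1 (s.lvl_d i k) hk, zero_mul]

theorem h_mulVec_eq_zero [Fintype κ] (s : LevelSplit ℓ ℓ' u) {v : κ → R} {i : ι}
    (hv : ∀ k, ℓ i = ℓ' k + 1 → v k = 0) : (s.h.mulVec v) i = 0 :=
  Finset.sum_eq_zero fun k _ => by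
    change s.h i k * v k = 0
    by_cases hk : ℓ i = ℓ' k + 1
    · rw [hv k hk, mul_zero]
    · rw [not_imp_comm.1 (s.lvl_h i k) hk, zero_mul]

theorem mulVec_eq [Fintype κ] (s : LevelSplit ℓ ℓ' u) (v : κ → R) (i : ι) :
    (u.mulVec v) i = (s.d.mulVec v) i + (s.h.mulVec v) i := by
  conv_lhs => rw [s.eq_add, Matrix.add_mulVec, Pi.add_apply]

/-- Only the entries of level one higher matter for the level lowering part. -/
theorem d_mulVec_congr [Fintype κ] (s : LevelSplit ℓ ℓ' u) {v w : κ → R} {i : ι}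
    (hv : ∀ k, ℓ' k = ℓ i + 1 → v k = w k) : (s.d.mulVec v) i = (s.d.mulVec w) i := by
  rw [← sub_eq_zero, ← Pi.sub_apply, ← Matrix.mulVec_sub]
  exact s.d_mulVec_eq_zero fun k hk => by rw [Pi.sub_apply, hv k hk, sub_self]

/-- The lifting step in the exactness of the resolution over `R / (W)` obtained from a resolution
over `R` and a null homotopy of `W`. -/
theorem exists_lift [Fintype ι] [Fintype κ] [DecidableEq ι] [DecidableEq κ] [IsDomain R] {W : R} (hW : W ≠ 0)
    (s : LevelSplit ℓ ℓ' u) (s' : LevelSplit ℓ' ℓ u')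
    (huu' : u * u' = W • (1 : Matrix ι ι R)) (hu'u : u' * u = W • (1 : Matrix κ κ R)) (n : ℕ)
    (hκ : ∀ k, ℓ' k % 2 = n % 2)
    (hex : ∀ v : κ → R, (∀ k, ℓ' k ≠ n → v k = 0) → s.d.mulVec v = 0 →
      ∃ w, v = s'.d.mulVec w)
    (z : κ → R) (hz : ∀ k, n < ℓ' k → z k = 0)
    (hz' : ∀ i, ℓ i + 1 ≤ n → W ∣ (u.mulVec z) i) :
    ∃ y : ι → R, (∀ i, n + 1 < ℓ i → y i = 0) ∧ ∀ k, ℓ' k ≤ n → (u'.mulVec y) k = z k := by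
  -- First approximation: `y = u z / W` in levels up to `n - 1`, and `0` above.
  have hy : ∀ i, ∃ c, (ℓ i + 1 ≤ n → (u.mulVec z) i = W * c) ∧ (n < ℓ i + 1 → c = 0) := by
    intro i
    by_cases hi : ℓ i + 1 ≤ n
    · obtain ⟨c, hc⟩ := hz' i hi
      exact ⟨c, fun _ => hc, fun h => by omega⟩
    · exact ⟨0, fun h => absurd h hi, fun _ => rfl⟩
  choose y hy hy0 using hy
  -- By parity `ℓ' k ≤ n - 2`, so row `k` of `u'` only meets levels where `W * y = u z`; then cancel
  -- `W` in `u' u z = W z`.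
  have hlow : ∀ k, ℓ' k + 1 ≤ n → (u'.mulVec y) k = z k := by
    intro k hk
    have h2 := hκ k
    apply mul_left_cancel₀ hW
    have h1 : (u'.mulVec (u.mulVec z)) k = W * z k := by
      rw [Matrix.mulVec_mulVec, hu'u, Matrix.smul_mulVec, Matrix.one_mulVec, Pi.smul_apply,
        smul_eq_mul]
    rw [← h1, Matrix.mulVec, Matrix.mulVec, dotProduct, dotProduct, Finset.mul_sum]
    refine Finset.sum_congr rfl fun i _ => ?_
    by_cases hi : ℓ i + 1 ≤ n
    · rw [hy i hi]; ring
    · rw [s'.apply_eq_zero (i := k) (k := i) (by omega) (by omega)]; ring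
  have hhigh : ∀ k, n < ℓ' k → (u'.mulVec y) k = 0 := fun k hk =>
    Finset.sum_eq_zero fun i _ => by
      change u' k i * y i = 0
      by_cases hi : ℓ i + 1 ≤ n
      · rw [s'.apply_eq_zero (i := k) (k := i) (by omega) (by omega), zero_mul]
      · rw [hy0 i (by omega), mul_zero]
  have hr : ∀ k, ℓ' k ≠ n → (z - u'.mulVec y) k = 0 := by
    intro k hk
    rw [Pi.sub_apply]
    rcases lt_or_gt_of_ne hk with h | h
    · rw [hlow k h, sub_self]
    · rw [hhigh k h, hz k h, sub_self]
  -- The error lives in level `n`, so its `d` lives in level `n - 1`. There `h` contributes nothing,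
  -- and `u (z - u' y) = u z - W y = 0`.
  have hdr : s.d.mulVec (z - u'.mulVec y) = 0 := by
    funext i
    rw [Pi.zero_apply]
    by_cases hi : ℓ i + 1 = n
    · have h1 := s.mulVec_eq (z - u'.mulVec y) i
      rw [s.h_mulVec_eq_zero fun k hk => hr k (by omega), add_zero] at h1
      rw [← h1, Matrix.mulVec_sub, Matrix.mulVec_mulVec, huu', Matrix.smul_mulVec,
        Matrix.one_mulVec, Pi.sub_apply, Pi.smul_apply, smul_eq_mul, hy i hi.le, sub_self]
    · exact s.d_mulVec_eq_zero fun k hk => hr k (by omega)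
  obtain ⟨w, hw⟩ := hex _ hr hdr
  -- Only level `n + 1` of `w` is kept: its `d` corrects level `n`, while its `h` lands in level `n
  -- + 2`, beyond the truncation.
  refine ⟨y + fun i => if ℓ i = n + 1 then w i else 0, fun i hi => ?_, fun k hk => ?_⟩
  · rw [Pi.add_apply, hy0 i (by omega), if_neg (by omega), add_zero]
  · rw [Matrix.mulVec_add, Pi.add_apply, s'.mulVec_eq (fun i => if ℓ i = n + 1 then w i else 0),
      s'.h_mulVec_eq_zero fun i hi => if_neg (by omega), add_zero]
    by_cases hkn : ℓ' k = n
    · rw [s'.d_mulVec_congr (w := w) fun i hi => if_pos (by omega), ← hw, Pi.sub_apply]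
      ring
    · rw [s'.d_mulVec_eq_zero fun i hi => if_neg (by omega), add_zero,
        hlow k (by omega)]

end LevelSplit

/-! ### Koszul resolutions, one regular element at a time -/

/-- The structure of a Koszul resolution of `R / I` with a null homotopy on a pair of matrices
`u₁`, `u₀`: they split into a level lowering differential `d` and a level raising homotopy `h`, and
the homology of `d` is `R / I`, in level `0`. -/
structure KoszulResolution {ι₀ ι₁ : Type} [Fintype ι₀] [Fintype ι₁] [DecidableEq ι₀]
    (u₁ : Matrix ι₀ ι₁ R) (u₀ : Matrix ι₁ ι₀ R) (I : Ideal R) where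
  lvl₀ : ι₀ → ℕ
  lvl₁ : ι₁ → ℕ
  even₀ : ∀ i, lvl₀ i % 2 = 0
  odd₁ : ∀ i, lvl₁ i % 2 = 1
  split₁ : LevelSplit lvl₀ lvl₁ u₁
  split₀ : LevelSplit lvl₁ lvl₀ u₀
  base : ι₀
  lvl_base : lvl₀ base = 0
  eq_base : ∀ i, lvl₀ i = 0 → i = base
  exact₁ : ∀ v, split₁.d.mulVec v = 0 → ∃ w, v = split₀.d.mulVec w
  exact₀ : ∀ v, split₀.d.mulVec v = 0 → ∃ w c, v = split₁.d.mulVec w + Pi.single base c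
  mem_ideal : ∀ w, (split₁.d.mulVec w) base ∈ I
  exists_of_mem : ∀ c ∈ I, ∃ w, split₁.d.mulVec w = Pi.single base c

namespace KoszulResolution

variable {ι₀ ι₁ : Type} [Fintype ι₀] [Fintype ι₁] [DecidableEq ι₀]
  {u₁ : Matrix ι₀ ι₁ R} {u₀ : Matrix ι₁ ι₀ R} {I : Ideal R}

theorem d_single_base (K : KoszulResolution u₁ u₀ I) (c : R) :
    K.split₀.d.mulVec (Pi.single K.base c) = 0 := by
  funext i
  refine K.split₀.d_mulVec_eq_zero fun k hk => Pi.single_eq_of_ne ?_ _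
  rintro rfl
  have := K.lvl_base
  omega

/-- The splitting of the differential of the tensor product with a rank one factorization. -/
def _root_.HybridPhase.LevelSplit.fromBlocks {ℓ : ι → ℕ} {ℓ' : κ → ℕ} {u : Matrix ι κ R}
    {u' : Matrix κ ι R} [DecidableEq ι] [DecidableEq κ] (s : LevelSplit ℓ ℓ' u)
    (s' : LevelSplit ℓ' ℓ u') (a b : R) :
    LevelSplit (Sum.elim ℓ fun k => ℓ' k + 1) (Sum.elim ℓ' fun i => ℓ i + 1)
      (Matrix.fromBlocks u (a • 1) (b • 1) (-u')) where
  d := Matrix.fromBlocks s.d (a • 1) 0 (-s'.d)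
  h := Matrix.fromBlocks s.h 0 (b • 1) (-s'.h)
  eq_add := by
    rw [Matrix.fromBlocks_add, ← s.eq_add, ← neg_add, ← s'.eq_add, add_zero, zero_add]
  lvl_d := by
    rintro (i | i) (k | k) h
    · exact s.lvl_d _ _ h
    · by_cases hik : i = k
      · simp [hik]
      · simp [Matrix.one_apply_ne hik] at h
    · exact absurd rfl h
    · simpa using s'.lvl_d i k (by simpa using h)
  lvl_h := by
    rintro (i | i) (k | k) h
    · exact s.lvl_h _ _ h
    · exact absurd rfl h
    · by_cases hik : i = k
      · simp [hik]
      · simp [Matrix.one_apply_ne hik] at h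
    · simpa using s'.lvl_h i k (by simpa using h)

/-- Adjoining an element that is regular modulo the ideal. -/
def step [DecidableEq ι₁] (K : KoszulResolution u₁ u₀ I) (a b : R) (ha : ∀ c, a * c ∈ I → c ∈ I) :
    KoszulResolution (Matrix.fromBlocks u₁ (a • 1) (b • 1) (-u₀))
      (Matrix.fromBlocks u₀ (a • 1) (b • 1) (-u₁)) (Ideal.span {a} ⊔ I) where
  lvl₀ := Sum.elim K.lvl₀ fun i => K.lvl₁ i + 1
  lvl₁ := Sum.elim K.lvl₁ fun i => K.lvl₀ i + 1
  even₀ := by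
    rintro (i | i)
    · exact K.even₀ i
    · have := K.odd₁ i
      simp only [Sum.elim_inr]
      omega
  odd₁ := by
    rintro (i | i)
    · exact K.odd₁ i
    · have := K.even₀ i
      simp only [Sum.elim_inr]
      omega
  split₁ := K.split₁.fromBlocks K.split₀ a b
  split₀ := K.split₀.fromBlocks K.split₁ a b
  base := Sum.inl K.base
  lvl_base := K.lvl_base
  eq_base := by
    rintro (i | i) h
    · rw [K.eq_base i h]
    · simp at h
  exact₁ v hv := by
    obtain ⟨v₁, v₀, rfl⟩ : ∃ v₁ v₀, v = Sum.elim v₁ v₀ := ⟨_, _, (Sum.elim_comp_inl_inr v).symm⟩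
    rw [LevelSplit.fromBlocks, Matrix.fromBlocks_mulVec, ← Sum.elim_zero_zero,
      Sum.elim_eq_iff] at hv
    simp only [Sum.elim_comp_inl, Sum.elim_comp_inr, Matrix.smul_mulVec, Matrix.one_mulVec,
      Matrix.zero_mulVec, zero_add, Matrix.neg_mulVec, neg_eq_zero] at hv
    -- The only use of regularity: `v₀` is a boundary up to a base class `c`, and the first
    -- closedness equation makes `a * c` a boundary, so `a * c`, hence `c`, lies in `I`.
    obtain ⟨w, hw⟩ : ∃ w, v₀ = K.split₁.d.mulVec w := by
      obtain ⟨w, c, hw⟩ := K.exact₀ v₀ hv.2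
      have h1 : K.split₁.d.mulVec (-(v₁ + a • w)) = a • Pi.single K.base c := by
        rw [Matrix.mulVec_neg, Matrix.mulVec_add, Matrix.mulVec_smul, ← sub_eq_zero, ← neg_eq_zero,
          ← hv.1, hw, smul_add]
        abel
      have h2 := K.mem_ideal (-(v₁ + a • w))
      rw [h1, Pi.smul_apply, Pi.single_eq_same, smul_eq_mul] at h2
      obtain ⟨w', hw'⟩ := K.exists_of_mem c (ha c h2)
      exact ⟨w + w', by rw [Matrix.mulVec_add, hw', hw]⟩
    obtain ⟨z, hz⟩ := K.exact₁ (v₁ + a • w) (by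
      rw [Matrix.mulVec_add, Matrix.mulVec_smul, ← hw, hv.1])
    refine ⟨Sum.elim z (-w), ?_⟩
    rw [LevelSplit.fromBlocks, Matrix.fromBlocks_mulVec, Sum.elim_eq_iff]
    simp only [Sum.elim_comp_inl, Sum.elim_comp_inr, Matrix.smul_mulVec, Matrix.one_mulVec,
      Matrix.zero_mulVec, zero_add, Matrix.neg_mulVec, Matrix.mulVec_neg, neg_neg, ← hz, ← hw]
    exact ⟨by simp, trivial⟩
  exact₀ v hv := by
    obtain ⟨v₀, v₁, rfl⟩ : ∃ v₁ v₀, v = Sum.elim v₁ v₀ := ⟨_, _, (Sum.elim_comp_inl_inr v).symm⟩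
    rw [LevelSplit.fromBlocks, Matrix.fromBlocks_mulVec, ← Sum.elim_zero_zero,
      Sum.elim_eq_iff] at hv
    simp only [Sum.elim_comp_inl, Sum.elim_comp_inr, Matrix.smul_mulVec, Matrix.one_mulVec,
      Matrix.zero_mulVec, zero_add, Matrix.neg_mulVec, neg_eq_zero] at hv
    -- Odd homology vanishes, so `v₁` is a boundary outright; the base class survives only in `v₀ +
    -- a • w`.
    obtain ⟨w, hw⟩ := K.exact₁ v₁ hv.2
    obtain ⟨z, c, hz⟩ := K.exact₀ (v₀ + a • w) (by
      rw [Matrix.mulVec_add, Matrix.mulVec_smul, ← hw, hv.1])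
    refine ⟨Sum.elim z (-w), c, ?_⟩
    rw [LevelSplit.fromBlocks, Matrix.fromBlocks_mulVec]
    simp only [Sum.elim_comp_inl, Sum.elim_comp_inr, Matrix.smul_mulVec, Matrix.one_mulVec,
      Matrix.zero_mulVec, zero_add, Matrix.neg_mulVec, Matrix.mulVec_neg, neg_neg, ← hw]
    rw [← Sum.elim_single_zero, ← Sum.elim_add_add, Sum.elim_eq_iff]
    refine ⟨?_, by simp⟩
    rw [add_right_comm, ← hz]
    simp
  mem_ideal w := by
    obtain ⟨w₁, w₀, rfl⟩ : ∃ v₁ v₀, w = Sum.elim v₁ v₀ := ⟨_, _, (Sum.elim_comp_inl_inr w).symm⟩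
    rw [LevelSplit.fromBlocks, Matrix.fromBlocks_mulVec]
    simp only [Sum.elim_comp_inl, Sum.elim_comp_inr, Matrix.smul_mulVec, Matrix.one_mulVec,
      Sum.elim_inl, Pi.add_apply, Pi.smul_apply, smul_eq_mul]
    exact add_mem (Ideal.mem_sup_right (K.mem_ideal _))
      (Ideal.mem_sup_left (Ideal.mul_mem_right _ _ (Ideal.mem_span_singleton_self a)))
  exists_of_mem c hc := by
    obtain ⟨y, hy, e, he, rfl⟩ := Submodule.mem_sup.1 hc
    obtain ⟨y, rfl⟩ := Ideal.mem_span_singleton'.1 hy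
    obtain ⟨w, hw⟩ := K.exists_of_mem e he
    -- The new generator over the base maps to `a`, which supplies the summand `y * a`.
    refine ⟨Sum.elim w (Pi.single K.base y), ?_⟩
    rw [LevelSplit.fromBlocks, Matrix.fromBlocks_mulVec]
    simp only [Sum.elim_comp_inl, Sum.elim_comp_inr, Matrix.smul_mulVec, Matrix.one_mulVec,
      Matrix.zero_mulVec, zero_add, Matrix.neg_mulVec, K.d_single_base, neg_zero, hw]
    rw [← Sum.elim_single_zero, Sum.elim_eq_iff]
    refine ⟨?_, rfl⟩
    rw [← Pi.single_smul, ← Pi.single_add, smul_eq_mul, mul_comm a y, add_comm]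

/-- The even exactness away from the base level. -/
theorem exact₀_of_base (K : KoszulResolution u₁ u₀ I) (v : ι₀ → R) (n : ℕ) (hn : n ≠ 0)
    (hv : ∀ k, K.lvl₀ k ≠ n → v k = 0) (hd : K.split₀.d.mulVec v = 0) :
    ∃ w, v = K.split₁.d.mulVec w := by
  obtain ⟨w, c, hw⟩ := K.exact₀ v hd
  refine ⟨fun i => if K.lvl₁ i = n + 1 then w i else 0, ?_⟩
  funext k
  by_cases hk : K.lvl₀ k = n
  · rw [K.split₁.d_mulVec_congr (w := w) fun i hi => if_pos (by omega), hw, Pi.add_apply,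
      Pi.single_eq_of_ne, add_zero]
    rintro rfl
    exact hn (hk ▸ K.lvl_base)
  · rw [hv k hk, K.split₁.d_mulVec_eq_zero fun i hi => if_neg (by omega)]

end KoszulResolution

/-- Restricting columns only drops the products indexed outside the range of `f`, and these vanish
by assumption. -/
theorem mulVec_submatrix_comp {α β : Type} [Fintype κ] [Fintype β] (M : Matrix ι κ R) (e : α → ι) (f : β → κ)
    (hf : f.Injective) (z : κ → R) (h : ∀ i k, k ∉ Set.range f → M (e i) k * z k = 0) :
    (M.submatrix e f).mulVec (z ∘ f) = (M.mulVec z) ∘ e := by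
  funext i
  exact Finset.sum_of_injOn f hf.injOn (fun _ _ => Finset.mem_coe.2 (Finset.mem_univ _))
    (fun k _ hk => h i k (by simpa using hk)) fun _ _ => rfl

end KoszulResolution

/-! ### Exactness of truncations over S/(W) -/

theorem redMap_mk (W : S) {ι ι' : Type} [Fintype ι] (A : Matrix ι' ι S) (v : ι → S) :
    redMap W A (fun j => Ideal.Quotient.mk (Ideal.span {W}) (v j)) =
      fun i => Ideal.Quotient.mk (Ideal.span {W}) (A.mulVec v i) := by
  funext i
  simp [redMap, Matrix.mulVec, dotProduct]

theorem exists_lift_quotient (W : S) {ι : Type} (v : ι → S ⧸ Ideal.span {W}) :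
    ∃ z : ι → S, v = fun j => Ideal.Quotient.mk (Ideal.span {W}) (z j) := by
  choose z hz using fun j => Ideal.Quotient.mk_surjective (v j)
  exact ⟨z, funext fun j => (hz j).symm⟩

/-- Exactness, over `S / (W)`, of the maps induced between the truncations of a levelled matrix
factorization. -/
theorem exact_redMap_submatrix {ι κ α β γ : Type} [Fintype ι] [Fintype κ] [DecidableEq ι]
    [DecidableEq κ] [Fintype α] [Fintype β] {ℓ : ι → ℕ} {ℓ' : κ → ℕ}
    {u : Matrix ι κ S} {u' : Matrix κ ι S} {W : S} (hW : W ≠ 0)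
    (s : LevelSplit ℓ ℓ' u) (s' : LevelSplit ℓ' ℓ u')
    (huu' : u * u' = W • (1 : Matrix ι ι S)) (hu'u : u' * u = W • (1 : Matrix κ κ S)) (n : ℕ)
    (hκ : ∀ k, ℓ' k % 2 = n % 2)
    (hex : ∀ v : κ → S, (∀ k, ℓ' k ≠ n → v k = 0) → s.d.mulVec v = 0 →
      ∃ w, v = s'.d.mulVec w)
    (eα : α → ι) (hα : eα.Injective) (hα' : ∀ i, i ∈ Set.range eα ↔ ℓ i ≤ n + 1)
    (eβ : β → κ) (hβ : eβ.Injective) (hβ' : ∀ k, k ∈ Set.range eβ ↔ ℓ' k ≤ n)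
    (eγ : γ → ι) (hγ' : ∀ i, i ∈ Set.range eγ ↔ ℓ i + 1 ≤ n) :
    Function.Exact (redMap W (u'.submatrix eβ eα)) (redMap W (u.submatrix eγ eβ)) := by
  classical
  intro v
  obtain ⟨v, rfl⟩ := exists_lift_quotient W v
  constructor
  · intro hv
    -- Extension by zero turns the truncated problem into one for the full matrices.
    set z : κ → S := Function.extend eβ v (fun _ => 0)
    have hzv : z ∘ eβ = v := funext fun b =>
      hβ.extend_apply v (fun _ => 0) b
    have hz0 : ∀ k, k ∉ Set.range eβ → z k = 0 := fun k hk =>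
      Function.extend_apply' v (fun _ => 0) k (by simpa using hk)
    rw [redMap_mk, ← hzv, mulVec_submatrix_comp u eγ eβ hβ z fun i k hk => by
      rw [hz0 k hk, mul_zero]] at hv
    obtain ⟨y, hy, hyz⟩ := s.exists_lift hW s' huu' hu'u n hκ hex z
      (fun k hk => hz0 k (by rw [hβ']; omega)) (fun i hi => by
        obtain ⟨c, rfl⟩ := (hγ' i).2 hi
        exact Ideal.mem_span_singleton.1 (Ideal.Quotient.eq_zero_iff_mem.1 (congrFun hv c)))
    refine ⟨fun a => Ideal.Quotient.mk _ ((y ∘ eα) a), ?_⟩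
    rw [redMap_mk, mulVec_submatrix_comp u' eβ eα hα y fun i k hk => by
      rw [hy k (by rw [hα'] at hk; omega), mul_zero]]
    funext b
    rw [Function.comp_apply, hyz _ ((hβ' _).1 ⟨b, rfl⟩), ← hzv, Function.comp_apply]
  · rintro ⟨y, hy⟩
    obtain ⟨y, rfl⟩ := exists_lift_quotient W y
    set z : ι → S := Function.extend eα y (fun _ => 0)
    have hzy : z ∘ eα = y := funext fun b => hα.extend_apply y (fun _ => 0) b
    have hz0 : ∀ k, k ∉ Set.range eα → z k = 0 := fun k hk =>
      Function.extend_apply' y (fun _ => 0) k (by simpa using hk)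
    rw [← hy, redMap_mk, ← hzy, mulVec_submatrix_comp u' eβ eα hα z fun i k hk => by
      rw [hz0 k hk, mul_zero], redMap_mk,
      -- Columns above level `n` do not meet rows of level at most `n - 1`, so the truncated
      -- composite is still `W`.
      mulVec_submatrix_comp u eγ eβ hβ _ fun i k hk => by
        have h1 := (hγ' (eγ i)).1 ⟨i, rfl⟩
        rw [hβ'] at hk
        rw [s.apply_eq_zero (by omega) (by omega), zero_mul],
      Matrix.mulVec_mulVec, huu', Matrix.smul_mulVec, Matrix.one_mulVec]
    funext i
    exact Ideal.Quotient.eq_zero_iff_mem.2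
      (Ideal.mul_mem_right _ _ (Ideal.mem_span_singleton_self W))

theorem IsGr.submatrix {ι ι' α α' : Type} {deg : ι → ℤ × ℤ} {deg' : ι' → ℤ × ℤ} {d : ℤ × ℤ}
    {A : Matrix ι' ι S} (hA : IsGr deg deg' d A) (e' : α' → ι') (e : α → ι) :
    IsGr (deg ∘ e) (deg' ∘ e') d (A.submatrix e' e) :=
  fun i j => hA (e' i) (e j)

/-! ### The resolution over S/(W) and membership in T_Σ -/

namespace KoszulResolution

variable {W : S} {P : MF W} {I : Ideal S} (K : KoszulResolution P.u₁ P.u₀ I)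

/-- The index type of the term of degree `2 m` of the resolution over `S / (W)`. -/
abbrev EvenTerm (m : ℕ) : Type := {i : P.ι₀ // K.lvl₀ i ≤ 2 * m}

/-- The index type of the term of degree `2 m + 1` of the resolution over `S / (W)`. -/
abbrev OddTerm (m : ℕ) : Type := {i : P.ι₁ // K.lvl₁ i ≤ 2 * m + 1}

/-- The degrees of the term of degree `2 m` of the resolution, normalized by `c`. -/
def evenDeg (c : ℤ) (m : ℕ) : P.ι₀ → ℤ × ℤ := fun i => P.deg₀ i + (0, c - m)

/-- The degrees of the term of degree `2 m + 1` of the resolution, normalized by `c`. -/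
def oddDeg (_ : KoszulResolution P.u₁ P.u₀ I) (c : ℤ) (m : ℕ) : P.ι₁ → ℤ × ℤ :=
  fun i => P.deg₁ i + (0, c - m)

theorem isGr_odd_even (c : ℤ) (m : ℕ) : IsGr (K.oddDeg c m) (evenDeg (P := P) c m) 0 P.u₁ :=
  P.gr₁.congr fun i j => by rw [evenDeg, oddDeg]; abel

theorem isGr_even_odd (c : ℤ) (m : ℕ) :
    IsGr (evenDeg (P := P) c (m + 1)) (K.oddDeg c m) 0 P.u₀ :=
  P.gr₀.congr fun i j => by rw [evenDeg, oddDeg]; ext <;> simp; ring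

/-- Two steps down in the resolution. -/
theorem isHigherSyzygy_step (hW : W ≠ 0) (c : ℤ) (m : ℕ) {α₁ α₀ : Type} [Fintype α₁] [Fintype α₀]
    (e₁ : α₁ → P.ι₁) (h₁ : e₁.Injective) (h₁' : ∀ i, i ∈ Set.range e₁ ↔ K.lvl₁ i ≤ 2 * m + 3)
    (e₀ : α₀ → P.ι₀) (h₀ : e₀.Injective) (h₀' : ∀ i, i ∈ Set.range e₀ ↔ K.lvl₀ i ≤ 2 * m + 2)
    (h : IsHigherSyzygy W P.deg₁ P.deg₀ P.u₁ (K.oddDeg c (m + 1) ∘ e₁)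
      (evenDeg (P := P) c (m + 1) ∘ e₀) (P.u₁.submatrix e₀ e₁)) :
    IsHigherSyzygy W P.deg₁ P.deg₀ P.u₁ (K.oddDeg c m ∘ fun i : K.OddTerm m => i.1)
      (evenDeg (P := P) c m ∘ fun i : K.EvenTerm m => i.1)
      (P.u₁.submatrix (fun i : K.EvenTerm m => i.1) fun i : K.OddTerm m => i.1) := by
  -- Keeping `e₁`, `e₀` general lets the upper terms be either truncations or, at the top, all of
  -- `P`.
  refine .step (evenDeg (P := P) c (m + 1) ∘ e₀) _ _
    (P.u₀.submatrix (fun i : K.OddTerm m => i.1) e₀) _ ?_ ((K.isGr_odd_even c m).submatrix _ _) ?_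
  · refine .step _ _ _ _ _ h ((K.isGr_even_odd c m).submatrix _ _) ?_
    -- The level `2 * m + 2` is positive, so the homology at the base does not interfere.
    exact exact_redMap_submatrix hW K.split₀ K.split₁ P.fact₁ P.fact₀ (2 * m + 2)
      (fun k => by rw [K.even₀]; omega)
      (fun v hv => K.exact₀_of_base v (2 * m + 2) (by omega) hv) e₁ h₁ h₁' e₀ h₀ h₀' _ fun i => by
        simp
  · exact exact_redMap_submatrix hW K.split₁ K.split₀ P.fact₀ P.fact₁ (2 * m + 1)
      (fun k => by rw [K.odd₁]; omega) (fun v _ => K.exact₁ v) e₀ h₀ h₀' _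
      Subtype.val_injective (fun i => by simp) _ fun i => by simp

/-- Descending induction from a degree beyond all levels, where the truncation is `P` itself, down
to the presentation in degree `0`. -/
theorem isHigherSyzygy (hW : W ≠ 0) : ∃ c : ℤ,
    IsHigherSyzygy W P.deg₁ P.deg₀ P.u₁ (K.oddDeg c 0 ∘ fun i : K.OddTerm 0 => i.1)
      (evenDeg (P := P) c 0 ∘ fun i : K.EvenTerm 0 => i.1)
      (P.u₁.submatrix (fun i : K.EvenTerm 0 => i.1) fun i : K.OddTerm 0 => i.1) := by
  obtain ⟨M, hM₀, hM₁⟩ : ∃ M, (∀ i, K.lvl₀ i ≤ 2 * M + 2) ∧ ∀ i, K.lvl₁ i ≤ 2 * M + 3 := by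
    refine ⟨Finset.univ.sup K.lvl₀ + Finset.univ.sup K.lvl₁, fun i => ?_, fun i => ?_⟩
    · have := Finset.le_sup (f := K.lvl₀) (Finset.mem_univ i)
      omega
    · have := Finset.le_sup (f := K.lvl₁) (Finset.mem_univ i)
      omega
  -- With this normalization the grading shift vanishes at `m = M + 1`, so the tail has exactly the
  -- degrees of `P`.
  refine ⟨M + 1, ?_⟩
  have key : IsHigherSyzygy W P.deg₁ P.deg₀ P.u₁
      (K.oddDeg (M + 1) M ∘ fun i : K.OddTerm M => i.1)
      (evenDeg (P := P) (M + 1) M ∘ fun i : K.EvenTerm M => i.1)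
      (P.u₁.submatrix (fun i : K.EvenTerm M => i.1) fun i : K.OddTerm M => i.1) := by
    refine K.isHigherSyzygy_step hW (M + 1) M id Function.injective_id (by simpa using hM₁) id
      Function.injective_id (by simpa using hM₀) ?_
    have h₁ : K.oddDeg (M + 1) (M + 1) ∘ id = P.deg₁ := by
      funext i
      simp [oddDeg]
    have h₀ : evenDeg (P := P) (M + 1) (M + 1) ∘ id = P.deg₀ := by
      funext i
      simp [evenDeg]
    rw [h₁, h₀]
    exact .refl
  have descend : ∀ k ≤ M, IsHigherSyzygy W P.deg₁ P.deg₀ P.u₁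
      (K.oddDeg (M + 1) (M - k) ∘ fun i : K.OddTerm (M - k) => i.1)
      (evenDeg (P := P) (M + 1) (M - k) ∘ fun i : K.EvenTerm (M - k) => i.1)
      (P.u₁.submatrix (fun i : K.EvenTerm (M - k) => i.1) fun i : K.OddTerm (M - k) => i.1) := by
    intro k
    induction k with
    | zero => exact fun _ => key
    | succ k ih =>
      intro hk
      obtain ⟨m, hm⟩ : ∃ m, M - k = m + 1 := ⟨M - k - 1, by omega⟩
      have ih := ih (by omega)
      rw [hm] at ih
      rw [show M - (k + 1) = m by omega]
      exact K.isHigherSyzygy_step hW (M + 1) m _ Subtype.val_injective (fun i => by simp; omega) _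
        Subtype.val_injective (fun i => by simp; omega) ih
  have h := descend M le_rfl
  rw [Nat.sub_self] at h
  exact_mod_cast h

/-- The degree `0` term is one copy of `S'`, at the base, and every element of `I` is hit from level
`1`; hence the first power of the Cox ideal suffices. -/
theorem killedByCoxPower (hI : coxIdeal ≤ I) :
    KilledByCoxPower W
      (P.u₁.submatrix (fun i : K.EvenTerm 0 => i.1) fun i : K.OddTerm 0 => i.1) := by
  refine ⟨1, fun s hs v => ?_⟩
  rw [pow_one] at hs
  obtain ⟨z, rfl⟩ := exists_lift_quotient W v
  obtain ⟨w, hw⟩ := K.exists_of_mem (s * z ⟨K.base, K.lvl_base.le⟩) (I.mul_mem_right _ (hI hs))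
  set y : P.ι₁ → S := fun i => if K.lvl₁ i = 1 then w i else 0 with hy
  refine ⟨fun j => Ideal.Quotient.mk _ ((y ∘ fun i : K.OddTerm 0 => i.1) j), ?_⟩
  rw [redMap_mk, mulVec_submatrix_comp _ _ _ Subtype.val_injective y fun i k hk => by
    have : ¬ K.lvl₁ k ≤ 1 := by simpa using hk
    rw [hy]
    simp only
    rw [if_neg (by omega), mul_zero]]
  funext i
  obtain ⟨i, hi⟩ := i
  obtain rfl := K.eq_base i (by omega)
  have hb := K.lvl_base
  rw [Function.comp_apply, K.split₁.mulVec_eq,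
    K.split₁.d_mulVec_congr (w := w) fun k hk => if_pos (hk.trans (by rw [hb])),
    K.split₁.h_mulVec_eq_zero fun k hk => absurd (hb.symm.trans hk) (by omega), hw, Pi.single_eq_same, add_zero, map_mul]
  rfl

/-- A matrix factorization that underlies a Koszul resolution of a module killed by the Cox ideal
lies in the subcategory `T_Σ`. -/
theorem inT (K : KoszulResolution P.u₁ P.u₀ I) (hW : W ≠ 0) (hI : coxIdeal ≤ I) : InT P := by
  obtain ⟨c, hc⟩ := K.isHigherSyzygy hW
  exact .ofModule P _ _ _ ((K.isGr_odd_even c 0).submatrix _ _) (K.killedByCoxPower hI) hc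

end KoszulResolution

/-! ### The Koszul matrix factorizations -/

/-- The trivial resolution of `S`. -/
def KoszulResolution.unit : KoszulResolution MF.unit.u₁ MF.unit.u₀ (⊥ : Ideal S) where
  lvl₀ _ := 0
  lvl₁ _ := 1
  even₀ _ := rfl
  odd₁ _ := rfl
  split₁ := ⟨0, 0, (add_zero _).symm, fun _ j => j.elim, fun _ j => j.elim⟩
  split₀ := ⟨0, 0, (add_zero _).symm, fun j => j.elim, fun j => j.elim⟩
  base := ()
  lvl_base := rfl
  eq_base _ _ := rfl
  exact₁ v _ := ⟨0, funext fun i => i.elim⟩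
  exact₀ v _ := ⟨0, v (), by
    rw [Matrix.mulVec_zero, zero_add]
    exact funext fun i => (Pi.single_eq_same (M := fun _ => S) i _).symm⟩
  mem_ideal w := by
    rw [Matrix.zero_mulVec]
    exact zero_mem _
  exists_of_mem c hc := ⟨0, by
    rw [(Ideal.mem_bot.1 hc : c = 0), Matrix.mulVec_zero]
    exact (Pi.single_zero _).symm⟩

/-- An ideal `I` of `S` is prime if it is killed by an endomorphism of `S` which is the identity
modulo `I`; elements not killed by the endomorphism are then regular modulo `I`. -/
theorem mem_of_mul_mem {I : Ideal S} (τ : S →ₐ[ℂ] S) (hτ : ∀ c ∈ I, τ c = 0)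
    (hI : ∀ j, MvPolynomial.X j - τ (MvPolynomial.X j) ∈ I) {a c : S} (ha : τ a ≠ 0)
    (h : a * c ∈ I) : c ∈ I := by
  have hsub : ∀ b, b - τ b ∈ I := by
    intro b
    rw [← Ideal.Quotient.eq]
    have : (Ideal.Quotient.mkₐ ℂ I) = (Ideal.Quotient.mkₐ ℂ I).comp τ :=
      MvPolynomial.algHom_ext fun j => Ideal.Quotient.eq.2 (hI j)
    exact DFunLike.congr_fun this b
  have h0 : τ c = 0 := by
    have := hτ _ h
    rw [map_mul] at this
    exact (mul_eq_zero.1 this).resolve_left ha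
  simpa [h0] using hsub c

/-- The ideal generated by the variables `x i`, `i ∈ l`. -/
def xIdeal (l : List (Fin 6)) : Ideal S := Ideal.span (x '' {i | i ∈ l})

theorem xIdeal_cons (i : Fin 6) (l : List (Fin 6)) :
    xIdeal (i :: l) = Ideal.span {x i} ⊔ xIdeal l := by
  rw [xIdeal, xIdeal, ← Ideal.span_union, ← Set.image_singleton, ← Set.image_union]
  congr 2
  ext j
  simp

/-- The endomorphism of `S` killing the variables `x i`, `i ∈ l`. -/
def killX (l : List (Fin 6)) : S →ₐ[ℂ] S :=
  MvPolynomial.aeval (Sum.elim p fun i => if i ∈ l then 0 else x i)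

@[simp] theorem killX_p (l : List (Fin 6)) (a : Fin 2) : killX l (p a) = p a := by
  simp [killX, p]

@[simp] theorem killX_x (l : List (Fin 6)) (i : Fin 6) :
    killX l (x i) = if i ∈ l then 0 else x i := by
  rw [killX, x, MvPolynomial.aeval_X, Sum.elim_inr]
  rfl

/-- Killing the listed variables retracts `S` onto a polynomial subring, a domain, with kernel
`xIdeal l`. -/
theorem mem_xIdeal_of_mul_mem (l : List (Fin 6)) {a c : S} (ha : killX l a ≠ 0)
    (h : a * c ∈ xIdeal l) : c ∈ xIdeal l := by
  refine mem_of_mul_mem (killX l) (fun c hc => ?_) ?_ ha h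
  · have : xIdeal l ≤ RingHom.ker (killX l) := by
      rw [xIdeal, Ideal.span_le]
      rintro _ ⟨i, hi, rfl⟩
      exact (killX_x l i).trans (if_pos hi)
    exact this hc
  · rintro (a | i)
    · change p a - killX l (p a) ∈ _
      rw [killX_p, sub_self]
      exact zero_mem _
    · change x i - killX l (x i) ∈ _
      rw [killX_x]
      split_ifs with hi
      · rw [sub_zero]
        exact Ideal.subset_span ⟨i, hi, rfl⟩
      · rw [sub_self]
        exact zero_mem _

/-- The Koszul matrix factorization on distinct variables `x i` is a Koszul resolution. -/
theorem nonempty_koszulResolution (b : Fin 6 → S) (d : Fin 6 → ℤ × ℤ)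
    (ha : ∀ i, Homog (x i) (d i)) (hb : ∀ i, Homog (b i) ((0, 1) - d i)) :
    ∀ l : List (Fin 6), l.Nodup → Nonempty (KoszulResolution (MF.koszul x b d ha hb l).u₁
      (MF.koszul x b d ha hb l).u₀ (xIdeal l))
  | [], _ => ⟨by
      have : xIdeal [] = ⊥ := by simp [xIdeal]
      rw [this]
      exact KoszulResolution.unit⟩
  | i :: l, hl => by
      obtain ⟨K⟩ := nonempty_koszulResolution b d ha hb l (List.nodup_cons.1 hl).2
      rw [xIdeal_cons]
      refine ⟨K.step (x i) (b i) fun c => mem_xIdeal_of_mul_mem l ?_⟩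
      rw [killX_x, if_neg (List.nodup_cons.1 hl).1]
      exact MvPolynomial.X_ne_zero _

/-! ### The cone of multiplication by a complementary linear form -/

/-- The linear form `ξ₀ p₁ - ξ₁ p₀`. -/
def linForm (ξ : Fin 2 → ℂ) : S := MvPolynomial.C (ξ 0) * p 1 - MvPolynomial.C (ξ 1) * p 0

theorem exists_complementary {ξ : Fin 2 → ℂ} (hξ : ξ ≠ 0) :
    ∃ η : Fin 2 → ℂ, ξ 0 * η 1 - ξ 1 * η 0 = 1 := by
  by_cases h : ξ 0 = 0
  · have h1 : ξ 1 ≠ 0 := fun h1 => hξ (funext fun i => by fin_cases i <;> assumption)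
    exact ⟨![-(ξ 1)⁻¹, 0], by simp [h1]⟩
  · exact ⟨![0, (ξ 0)⁻¹], by simp [h]⟩

/-- The ideal `(x, ξ₀ p₁ - ξ₁ p₀)`. -/
def pointIdeal (ξ : Fin 2 → ℂ) : Ideal S := Ideal.span {linForm ξ} ⊔ xIdeal (List.finRange 6)

/-- The endomorphism of `S` with `x ↦ 0`, `p ↦ ξ t`, where `t = η₁ p₀ - η₀ p₁`. -/
def restrictPoint (ξ η : Fin 2 → ℂ) : S →ₐ[ℂ] S :=
  MvPolynomial.aeval (Sum.elim (fun a => MvPolynomial.C (ξ a) * -linForm η) fun _ => 0)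

theorem restrictPoint_p (ξ η : Fin 2 → ℂ) (a : Fin 2) :
    restrictPoint ξ η (p a) = MvPolynomial.C (ξ a) * -linForm η := by
  simp [restrictPoint, p]

theorem restrictPoint_x (ξ η : Fin 2 → ℂ) (i : Fin 6) : restrictPoint ξ η (x i) = 0 := by
  simp [restrictPoint, x]

theorem restrictPoint_linForm (ξ η ζ : Fin 2 → ℂ) : restrictPoint ξ η (linForm ζ) =
    MvPolynomial.C (ζ 1 * ξ 0 - ζ 0 * ξ 1) * linForm η := by
  have hC : ∀ c : ℂ, restrictPoint ξ η (MvPolynomial.C c) = MvPolynomial.C c := fun c =>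
    (restrictPoint ξ η).commutes c
  rw [linForm, map_sub, map_mul, map_mul, hC, hC, restrictPoint_p, restrictPoint_p]
  simp only [map_sub, map_mul]
  ring

theorem linForm_ne_zero {ξ : Fin 2 → ℂ} (hξ : ξ ≠ 0) : linForm ξ ≠ 0 := by
  obtain ⟨η, hη⟩ := exists_complementary hξ
  intro h
  -- At `p = η` the form takes the value `ξ₀η₁ - ξ₁η₀ = 1`.
  have := congrArg (MvPolynomial.eval (Sum.elim η fun _ => 0)) h
  simp [linForm, p, hη] at this

theorem killX_linForm (l : List (Fin 6)) (ξ : Fin 2 → ℂ) : killX l (linForm ξ) = linForm ξ := by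
  have hC : ∀ c : ℂ, killX l (MvPolynomial.C c) = MvPolynomial.C c := fun c => (killX l).commutes c
  rw [linForm, map_sub, map_mul, map_mul, hC, hC, killX_p, killX_p]

/-- Cramer's rule for the determinant `1` change of basis between `p₀, p₁` and the two linear forms.
-/
theorem p_eq_linForm {ξ η : Fin 2 → ℂ} (h : ξ 0 * η 1 - ξ 1 * η 0 = 1) (a : Fin 2) :
    p a = MvPolynomial.C (ξ a) * -linForm η + MvPolynomial.C (η a) * linForm ξ := by
  have h' : (MvPolynomial.C (ξ 0) * MvPolynomial.C (η 1) -
      MvPolynomial.C (ξ 1) * MvPolynomial.C (η 0) : S) = 1 := by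
    rw [← map_mul, ← map_mul, ← map_sub, h, map_one]
  fin_cases a <;> simp only [linForm, Fin.zero_eta, Fin.mk_one, Fin.isValue]
  · linear_combination (-p 0) * h'
  · linear_combination (-p 1) * h'

/-- Restriction to the line `x = 0`, `p ∈ ℂξ` kills the ideal and is the identity modulo it; it
fixes the nonzero form `linForm η`. -/
theorem mem_pointIdeal_of_mul_mem {ξ η : Fin 2 → ℂ} (h : ξ 0 * η 1 - ξ 1 * η 0 = 1) {c : S}
    (hc : linForm η * c ∈ pointIdeal ξ) : c ∈ pointIdeal ξ := by
  refine mem_of_mul_mem (restrictPoint ξ η) (fun c hc => ?_) ?_ ?_ hc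
  · have : pointIdeal ξ ≤ RingHom.ker (restrictPoint ξ η) := by
      rw [pointIdeal, sup_le_iff, xIdeal, Ideal.span_le, Ideal.span_le]
      constructor
      · rintro _ rfl
        refine (restrictPoint_linForm ξ η ξ).trans ?_
        rw [mul_comm (ξ 1), sub_self, map_zero, zero_mul]
      · rintro _ ⟨i, -, rfl⟩
        exact restrictPoint_x ξ η i
    exact this hc
  · rintro (a | i)
    · change p a - restrictPoint ξ η (p a) ∈ _
      rw [restrictPoint_p]
      rw [sub_eq_of_eq_add' (p_eq_linForm h a)]
      exact Ideal.mul_mem_left _ _ (Ideal.mem_sup_left (Ideal.mem_span_singleton_self _))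
    · change x i - restrictPoint ξ η (x i) ∈ _
      rw [restrictPoint_x, sub_zero]
      exact Ideal.mem_sup_right (Ideal.subset_span ⟨i, List.mem_finRange i, rfl⟩)
  · rw [restrictPoint_linForm, show η 1 * ξ 0 - η 0 * ξ 1 = 1 by linear_combination h, map_one,
      one_mul]
    refine linForm_ne_zero ?_
    rintro rfl
    simp at h

theorem coxIdeal_le {ξ η : Fin 2 → ℂ} (h : ξ 0 * η 1 - ξ 1 * η 0 = 1) :
    coxIdeal ≤ Ideal.span {linForm η} ⊔ pointIdeal ξ := by
  have hp : ∀ a, p a ∈ Ideal.span {linForm η} ⊔ pointIdeal ξ := by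
    intro a
    rw [p_eq_linForm h a]
    exact add_mem (Ideal.mul_mem_left _ _ (neg_mem (Ideal.mem_sup_left
      (Ideal.mem_span_singleton_self _)))) (Ideal.mul_mem_left _ _ (Ideal.mem_sup_right
      (Ideal.mem_sup_left (Ideal.mem_span_singleton_self _))))
  rw [coxIdeal, Ideal.span_le]
  rintro _ (rfl | rfl) <;> exact hp _

theorem smul_one_mul_comm {R ι κ : Type} [CommRing R] [Fintype ι] [Fintype κ] [DecidableEq ι]
    [DecidableEq κ] (t : R) (A : Matrix ι κ R) :
    (t • (1 : Matrix ι ι R)) * A = A * (t • (1 : Matrix κ κ R)) := by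
  simp

/-! ### The comparison morphism and its cone -/

section ZeroBrane

variable (f : Fin 2 → MvPolynomial (Fin 6) ℂ) (hf : ∀ a, (f a).IsHomogeneous 3)

/-- Multiplication by `t`, as a morphism between the cones of multiplication by `s`. -/
def coneMul {W : S} (P : MF W) (s t : S) (m m' n n' : ℤ) (hs : Homog s (n - m, 1))
    (hs' : Homog s (n' - m', 1)) (ht : Homog t (n - n', 1)) (hm : n - n' = m - m') :
    MF.cone (P.mulHom s m' n' hs') ⟶ (MF.cone (P.mulHom s m n hs)).shift.shift :=
  MF.Hom.mk (P := MF.cone (P.mulHom s m' n' hs')) (Q := (MF.cone (P.mulHom s m n hs)).shift.shift)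
    (t • (1 : Matrix (P.ι₀ ⊕ P.ι₁) (P.ι₀ ⊕ P.ι₁) S))
    (t • (1 : Matrix (P.ι₁ ⊕ P.ι₀) (P.ι₁ ⊕ P.ι₀) S))
    (.smul_one (deg := (MF.cone (P.mulHom s m' n' hs')).deg₀)
      (deg₁ := (MF.cone (P.mulHom s m n hs)).shift.shift.deg₀) ht (by
        rintro (i | i)
        · change (n - n', 1) = P.deg₀ i + (n, 0) + (0, 1) - (P.deg₀ i + (n', 0)) + 0
          ext <;> simp
        · change (n - n', 1) = P.deg₁ i + (m, 0) - (0, 1) + (0, 1) + (0, 1) -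
            (P.deg₁ i + (m', 0) - (0, 1) + (0, 1)) + 0
          ext <;> simp [hm]))
    (.smul_one (deg := (MF.cone (P.mulHom s m' n' hs')).deg₁)
      (deg₁ := (MF.cone (P.mulHom s m n hs)).shift.shift.deg₁) ht (by
        rintro (i | i)
        · change (n - n', 1) = P.deg₁ i + (n, 0) + (0, 1) - (P.deg₁ i + (n', 0)) + 0
          ext <;> simp
        · change (n - n', 1) = P.deg₀ i + (m, 0) - (0, 1) + (0, 1) -
            (P.deg₀ i + (m', 0) - (0, 1)) + 0
          ext <;> simp [hm]))
    -- Twists and double shifts change only degrees, so both cones have the same matrices and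
    -- scalars commute with them.
    (smul_one_mul_comm t (MF.cone (P.mulHom s m n hs)).u₁)
    (smul_one_mul_comm t (MF.cone (P.mulHom s m n hs)).u₀)

/-- Multiplication by `η₀ p₁ - η₁ p₀`, as a morphism `P_ξ(n+3) → P_ξ(n)[2]`. -/
def zeroBraneMul (ξ η : Fin 2 → ℂ) (n : ℤ) :
    zeroBrane f hf ξ (n + 3) ⟶ (zeroBrane f hf ξ n).shift.shift :=
  coneMul (wMF f hf) (linForm ξ) (linForm η) (n + 3) (n + 3 + 3) n (n + 3) (homog_linear ξ n)
    (homog_linear ξ (n + 3)) (homog_linear η n) (by ring)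

/-- Apart from degrees, the cone of multiplication by `s` is the Koszul step for the pair `(s, 0)`.
Here `s` involves only the `p_a`, hence is regular modulo the `x_i`. -/
theorem nonempty_koszulResolution_zeroBrane {ξ : Fin 2 → ℂ} (hξ : ξ ≠ 0) (n : ℤ) :
    Nonempty (KoszulResolution (zeroBrane f hf ξ n).u₁ (zeroBrane f hf ξ n).u₀
      (pointIdeal ξ)) := by
  obtain ⟨K⟩ := nonempty_koszulResolution (gCoeff f) (fun _ => (1, 0)) homog_x (homog_gCoeff hf)
    (List.finRange 6) (List.nodup_finRange 6)
  have K' := K.step (linForm ξ) 0 fun c => mem_xIdeal_of_mul_mem _ (by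
    rw [killX_linForm]
    exact linForm_ne_zero hξ)
  rw [zero_smul, zero_smul] at K'
  exact ⟨K'⟩

/-- A second cone adjoins `linForm η`, and the resulting ideal contains both `p₀` and `p₁`. -/
theorem inT_cone_zeroBraneMul (hW : superpotential f ≠ 0) {ξ η : Fin 2 → ℂ}
    (h : ξ 0 * η 1 - ξ 1 * η 0 = 1) (n : ℤ) : InT (MF.cone (zeroBraneMul f hf ξ η n)) := by
  have hξ : ξ ≠ 0 := by
    rintro rfl
    simp at h
  obtain ⟨K⟩ := nonempty_koszulResolution_zeroBrane f hf hξ n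
  have K' := K.step (linForm η) 0 fun c => mem_pointIdeal_of_mul_mem h
  rw [zero_smul, zero_smul] at K'
  exact KoszulResolution.inT (P := MF.cone (zeroBraneMul f hf ξ η n)) K' hW (coxIdeal_le h)

/-- If `W = 0`, setting `p` to a unit vector gives `f_a = 0` for each `a`; then the zero gradients
at `(1, …, 1)` contradict the Jacobian criterion. -/
theorem superpotential_ne_zero (hsmooth : IsSmoothCI f) : superpotential f ≠ 0 := by
  intro hW
  have hf0 : ∀ a, f a = 0 := by
    intro a
    have := congrArg (MvPolynomial.aeval (Sum.elim (fun b => if b = a then 1 else 0)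
      (MvPolynomial.X : Fin 6 → MvPolynomial (Fin 6) ℂ))) hW
    fin_cases a <;> simpa [superpotential, inS, p, MvPolynomial.bind₁_rename, Function.comp_def,
      MvPolynomial.bind₁_X_left] using this
  have h := hsmooth (fun _ => 1) (fun h => one_ne_zero (congrFun h 0)) fun a => by rw [hf0, map_zero]
  exact h.ne_zero 0 (funext fun i => by simp [hf0])

end ZeroBrane

end HybridPhase

end

/-- The isomorphism `P_ξ(n+3) ≅ P_ξ(n)[2]` in the category of D-branes of the hybrid phase of a
smooth bicubic complete intersection, for every `[ξ₀, ξ₁] ∈ ℙ¹` and every integer `n`. -/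
theorem mainTheorem3 (f : Fin 2 → MvPolynomial (Fin 6) ℂ) (hf : ∀ a, (f a).IsHomogeneous 3)
    (hsmooth : HybridPhase.IsSmoothCI f) (ξ : Fin 2 → ℂ) (hξ : ξ ≠ 0) (n : ℤ) :
    Nonempty (HybridPhase.brane (HybridPhase.zeroBrane f hf ξ (n + 3)) ≅
      HybridPhase.brane (HybridPhase.zeroBrane f hf ξ n).shift.shift) := by
  obtain ⟨η, h⟩ := HybridPhase.exists_complementary hξ
  have hmem : HybridPhase.coneInT (HybridPhase.superpotential f)
      ((CategoryTheory.Quotient.functor (HybridPhase.MF.homotopic _)).map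
        (HybridPhase.zeroBraneMul f hf ξ η n)) :=
    ⟨HybridPhase.zeroBraneMul f hf ξ η n, rfl, HybridPhase.inT_cone_zeroBraneMul f hf
      (HybridPhase.superpotential_ne_zero f hsmooth) h n⟩
  exact ⟨Localization.Construction.wIso _ hmem⟩
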